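/- Let $m\ge 1$, $f_1,\dots,f_m:\mathbb R^d\to\mathbb R$, and $f=\frac1m\sum_{i=1}^m f_i$. Norms are Euclidean/spectral, and $\mathcal R(A)$ is the range of $A$. Assume the following. 1. Each $f_i$ is twice differentiable and there are $K_i,L_i\in(0,\infty)$ with $\|\nabla f_i(x)-\nabla f_i(y)\|\le K_i\|x-y\|$ and $\|\nabla^2 f_i(x)-\nabla^2 f_i(y)\|\le L_i\|x-y\|$ for all $x,y\in\mathbb R^d$. 2. For each $i$ there is $\gamma_i\in(0,\infty)$ with $\|\nabla^2 f_i(w)p\|\ge\gamma_i\|p\|$ for all $w\in\mathbb R^d$ and $p\in\mathcal R(\nabla^2 f_i(w))$; moreover $\gamma_i\le K_i$ (which is automatic unless $\nabla^2 f_i\equiv 0$). 3. There is $\gamma\in(0,\infty)$ with $\|\nabla^2 f(w)p\|\ge\gamma\|p\|$ for all $w\in\mathbb R^d$ and $p\in\mathcal R(\nabla^2 f(w))$. 4. There is $\nu\in(0,1]$ such that for all $w\in\mathbb R^d$, $\|(U_w^\perp)^T\nabla f(w)\|^2\le\frac{1-\nu}{\nu}\|U_w^T\nabla f(w)\|^2$,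 where $U_w$ and $U_w^\perp$ denote arbitrary orthonormal bases of $\mathcal R(\nabla^2 f(w))$ and of its orthogonal complement. Fix $\theta>0$, $\phi>0$, $\rho\in(0,1)$, a gradient tolerance $\delta\ge0$, a maximal number $T$ of iterations and an initial point $w_0$. Write $g_t=\nabla f(w_t)$, $H_t=\nabla^2 f(w_t)$, $H_{t,i}=\nabla^2 f_i(w_t)$ and $\tilde H_{t,i}=\begin{bmatrix}H_{t,i}\\ \phi I\end{bmatrix}$. DINGO with inexact update: for $t=0,1,\dots,T-1$, stop if $\|g_t\|\le\delta$; otherwise iteration $t$ is carried out as follows. Each worker $i$ supplies vectors $v^{(1)}_{t,i},v^{(2)}_{t,i},v^{(3)}_{t,i}$ satisfying the Inexactness Condition $$\|H_{t,i}^2v^{(1)}_{t,i}-H_{t,i}g_t\|\le\varepsilon^{(1)}_i\|H_{t,i}g_t\|,\qquad v^{(1)}_{t,i}\in\mathcal R(H_{t,i}),$$ $$\|\tilde H_{t,i}^T\tilde H_{t,i}v^{(2)}_{t,i}-H_{t,i}g_t\|\le\varepsilon^{(2)}_i\|H_{t,i}g_t\|,$$ $$\|\tilde H_{t,i}^T\tilde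 H_{t,i}v^{(3)}_{t,i}-H_tg_t\|\le\varepsilon^{(3)}_i\|H_tg_t\|,\qquad \langle v^{(3)}_{t,i},H_tg_t\rangle>0,$$ with constants $0\le\varepsilon^{(1)}_i,\varepsilon^{(2)}_i,\varepsilon^{(3)}_i<1$ and $\varepsilon^{(3)}_i<\sqrt{\phi^2/(K_i^2+\phi^2)}$ for all $i$. Set $p_t=\frac1m\sum_{i=1}^m p_{t,i}$, where: - (Case 1*) if $\langle\frac1m\sum_i v^{(1)}_{t,i},H_tg_t\rangle\ge\theta\|g_t\|^2$, then $p_{t,i}=-v^{(1)}_{t,i}$ for all $i$; - (Case 2*) otherwise, if $\langle\frac1m\sum_i v^{(2)}_{t,i},H_tg_t\rangle\ge\theta\|g_t\|^2$, then $p_{t,i}=-v^{(2)}_{t,i}$ for all $i$; - (Case 3*) otherwise, $p_{t,i}=-v^{(2)}_{t,i}-\lambda_{t,i}v^{(3)}_{t,i}$ with $\lambda_{t,i}=\dfrac{-\langle v^{(2)}_{t,i},H_tg_t\rangle+\theta\|g_t\|^2}{\langle v^{(3)}_{t,i},H_tg_t\rangle}$ for those $i$ with $\langle v^{(2)}_{t,i},H_tg_t\rangle<\theta\|g_t\|^2$,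 and $p_{t,i}=-v^{(2)}_{t,i}$ for the other $i$. Then $w_{t+1}=w_t+\alpha_tp_t$, where $\alpha_t$ is the largest $\alpha\in(0,1]$ such that $\|\nabla f(w_t+\alpha p_t)\|^2\le\|g_t\|^2+2\alpha\rho\langle p_t,H_tg_t\rangle$. Put $L(w_0)=\big(\frac1m\sum_iK_i\big)^2+\big(\frac1m\sum_iL_i\big)\|\nabla f(w_0)\|$, $\kappa_i=(K_i^2+\phi^2)/\phi^2$, and $$\tilde\tau_1=\frac{2(1-\rho)\theta}{L(w_0)}\bigg(\frac1m\sum_{i=1}^m\frac{\gamma_i+\varepsilon^{(1)}_iK_i}{\gamma_i^2}\bigg)^{-2},\qquad \tilde\tau_2=\frac{2(1-\rho)\theta}{L(w_0)c_2^2},\qquad \tilde\tau_3=\frac{2(1-\rho)\theta}{L(w_0)c_3^2},$$ $$c_2=\frac1\phi\bigg(1+\frac1m\sum_{i=1}^m\varepsilon^{(2)}_i\kappa_i\bigg),\qquad c_3=c_2+\frac1m\sum_{i=1}^m\frac{1+\varepsilon^{(3)}_i\kappa_i}{1-\varepsilon^{(3)}_i\sqrt{\kappa_i}}\bigg(\frac1\phi\big(1+\varepsilon^{(2)}_i\kappa_i\big)+\frac{\theta}{\gamma\sqrt\nu}\bigg)\sqrt{\kappa_i}.$$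 Then at every iteration $t$ that is carried out, the largest step-size $\alpha_t\in(0,1]$ exists, and $$\|g_{t+1}\|^2\le(1-2\tilde\tau\rho\theta)\|g_t\|^2,\qquad \tilde\tau=\min\{\tilde\tau_1,\tilde\tau_2,\tilde\tau_3\}.$$ -/

import Mathlib

noncomputable section

namespace DINGO

/-- Euclidean space `ℝ^d` with the `ℓ₂` norm. -/
abbrev Vec (d : ℕ) : Type := EuclideanSpace ℝ (Fin d)

/-- The average `(1/m) ∑ i, v i` of vectors held by `m` workers. -/
def avg {d m : ℕ} (v : Fin m → Vec d) : Vec d := (m : ℝ)⁻¹ • ∑ i, v i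

/-- The average `(1/m) ∑ i, a i` of real numbers. -/
def mean {m : ℕ} (a : Fin m → ℝ) : ℝ := (m : ℝ)⁻¹ * ∑ i, a i

/-- The objective `f = (1/m) ∑ i, f_i`. -/
def objective {d m : ℕ} (F : Fin m → Vec d → ℝ) : Vec d → ℝ := fun w => mean fun i => F i w

/-- The Hessian, as the derivative of the gradient; its operator norm is the spectral norm. -/
def hess {d : ℕ} (f : Vec d → ℝ) (w : Vec d) : Vec d →L[ℝ] Vec d := fderiv ℝ (gradient f) w

/-- The stacked matrix `[H; φ I]`, as a map from `ℝ^d` to `ℝ^d × ℝ^d` with the Euclidean norm. -/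
def stacked {d : ℕ} (φ : ℝ) (H : Vec d →L[ℝ] Vec d) : Vec d →L[ℝ] WithLp 2 (Vec d × Vec d) :=
  ((WithLp.prodContinuousLinearEquiv 2 ℝ (Vec d) (Vec d)).symm :
      (Vec d × Vec d) →L[ℝ] WithLp 2 (Vec d × Vec d)) ∘L
    (H.prod (φ • ContinuousLinearMap.id ℝ (Vec d)))

/-- The regularized normal matrix `[H; φ I]ᵀ [H; φ I]`. -/
def normalMap {d : ℕ} (φ : ℝ) (H : Vec d →L[ℝ] Vec d) : Vec d →L[ℝ] Vec d :=
  ContinuousLinearMap.adjoint (stacked φ H) ∘L stacked φ H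

/-! ### Assumptions on the objective -/

/-- Every `f_i` is twice differentiable, with `K_i`-Lipschitz gradient and `L_i`-Lipschitz
Hessian, where `K_i, L_i` are positive. -/
def LocalLipschitz {d m : ℕ} (F : Fin m → Vec d → ℝ) (K L : Fin m → ℝ) : Prop :=
  ∀ i, Differentiable ℝ (F i) ∧ Differentiable ℝ (gradient (F i)) ∧ 0 < K i ∧ 0 < L i ∧
    ∀ x y, ‖gradient (F i) x - gradient (F i) y‖ ≤ K i * ‖x - y‖ ∧
      ‖hess (F i) x - hess (F i) y‖ ≤ L i * ‖x - y‖

/-- `‖∇²h(w) p‖ ≥ γ ‖p‖` for all `w` and all `p` in the range of `∇²h(w)`, where `γ > 0`. -/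
def PseudoInverseRegular {d : ℕ} (h : Vec d → ℝ) (γ : ℝ) : Prop :=
  0 < γ ∧ ∀ w, ∀ p ∈ (hess h w).range, γ * ‖p‖ ≤ ‖hess h w p‖

/-- Gradient-Hessian null-space property with `ν ∈ (0,1]`: with (the columns of) `U` and `U'`
orthonormal bases of the range of `∇²h(w)` and of its orthogonal complement,
`‖U'ᵀ ∇h(w)‖² ≤ (1-ν)/ν * ‖Uᵀ ∇h(w)‖²`. -/
def GradientHessianNullSpace {d : ℕ} (h : Vec d → ℝ) (ν : ℝ) : Prop :=
  0 < ν ∧ ν ≤ 1 ∧ ∀ w, ∀ (r s : ℕ)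
    (U : OrthonormalBasis (Fin r) ℝ (hess h w).range)
    (U' : OrthonormalBasis (Fin s) ℝ ((hess h w).range)ᗮ),
    ∑ j, (inner ℝ (U' j : Vec d) (gradient h w)) ^ 2 ≤
      (1 - ν) / ν * ∑ j, (inner ℝ (U j : Vec d) (gradient h w)) ^ 2

/-! ### The algorithm with inexact update -/

/-- In Case 3*, the contribution `p_{t,i}` of worker `i`, where `g = g_t` and `Hg = H_t g_t`:
`-v²` outside the index set, and `-v² - λ v³` in it. -/
def case3Local {d : ℕ} (θ : ℝ) (g Hg v2 v3 : Vec d) : Vec d :=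
  if inner ℝ v2 Hg < θ * ‖g‖ ^ 2 then
    -v2 - ((-inner ℝ v2 Hg + θ * ‖g‖ ^ 2) / inner ℝ v3 Hg) • v3
  else -v2

/-- The update direction `p_t`: Cases 1*, 2* and 3*, tried in this order. -/
def direction {d m : ℕ} (θ : ℝ) (g Hg : Vec d) (v1 v2 v3 : Fin m → Vec d) : Vec d :=
  if θ * ‖g‖ ^ 2 ≤ inner ℝ (avg v1) Hg then avg fun i => -v1 i
  else if θ * ‖g‖ ^ 2 ≤ inner ℝ (avg v2) Hg then avg fun i => -v2 i
  else avg fun i => case3Local θ g Hg (v2 i) (v3 i)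

/-- The step-sizes in `(0,1]` that pass the line search at `w` along `p`. -/
def lineSearchSet {d : ℕ} (f : Vec d → ℝ) (ρ : ℝ) (w p : Vec d) : Set ℝ :=
  {α | 0 < α ∧ α ≤ 1 ∧ ‖gradient f (w + α • p)‖ ^ 2 ≤
    ‖gradient f w‖ ^ 2 + 2 * α * ρ * inner ℝ p (hess f w (gradient f w))}

/-- The line search step-size: the largest element of `lineSearchSet` if there is one. -/
def stepSize {d : ℕ} (f : Vec d → ℝ) (ρ : ℝ) (w p : Vec d) : ℝ := sSup (lineSearchSet f ρ w p)

/-- Iteration `t` is carried out: it is within the budget of `T` iterations, and the stopping test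
`‖g_s‖ ≤ δ` has failed at all `s ≤ t`. -/
def Performs {d : ℕ} (f : Vec d → ℝ) (δ : ℝ) (T : ℕ) (w : ℕ → Vec d) (t : ℕ) : Prop :=
  t < T ∧ ∀ s ≤ t, δ < ‖gradient f (w s)‖

/-- The direction `p_t` used at iteration `t`. -/
def dirAt {d m : ℕ} (F : Fin m → Vec d → ℝ) (θ : ℝ) (w : ℕ → Vec d)
    (v1 v2 v3 : ℕ → Fin m → Vec d) (t : ℕ) : Vec d :=
  direction θ (gradient (objective F) (w t))
    (hess (objective F) (w t) (gradient (objective F) (w t))) (v1 t) (v2 t) (v3 t)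

/-- `w 0, w 1, …` are the iterates of the algorithm run with inexact update from `w 0`, where
worker `i` supplies the vectors `v1 t i`, `v2 t i`, `v3 t i` at iteration `t`. Nothing is said
about `w` after termination. -/
def IsInexactRun {d m : ℕ} (F : Fin m → Vec d → ℝ) (θ ρ δ : ℝ) (T : ℕ) (w : ℕ → Vec d)
    (v1 v2 v3 : ℕ → Fin m → Vec d) : Prop :=
  ∀ t, Performs (objective F) δ T w t →
    w (t + 1) = w t + stepSize (objective F) ρ (w t) (dirAt F θ w v1 v2 v3 t) •
      dirAt F θ w v1 v2 v3 t

/-- The inexactness condition, at the iterations that are carried out, with tolerances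
`ε1, ε2, ε3` in `[0,1)`. -/
def InexactnessCondition {d m : ℕ} (F : Fin m → Vec d → ℝ) (φ δ : ℝ) (T : ℕ) (w : ℕ → Vec d)
    (v1 v2 v3 : ℕ → Fin m → Vec d) (ε1 ε2 ε3 : Fin m → ℝ) : Prop :=
  (∀ i, (0 ≤ ε1 i ∧ ε1 i < 1) ∧ (0 ≤ ε2 i ∧ ε2 i < 1) ∧ (0 ≤ ε3 i ∧ ε3 i < 1)) ∧
  ∀ t, Performs (objective F) δ T w t → ∀ i,
    let g := gradient (objective F) (w t)
    let Hg := hess (objective F) (w t) g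
    let Hi := hess (F i) (w t)
    (‖Hi (Hi (v1 t i)) - Hi g‖ ≤ ε1 i * ‖Hi g‖ ∧ v1 t i ∈ Hi.range) ∧
    ‖normalMap φ Hi (v2 t i) - Hi g‖ ≤ ε2 i * ‖Hi g‖ ∧
    (‖normalMap φ Hi (v3 t i) - Hg‖ ≤ ε3 i * ‖Hg‖ ∧ 0 < inner ℝ (v3 t i) Hg)

/-! ### The rate constants -/

/-- `L(w₀) = (∑ K_i / m)² + (∑ L_i / m) ‖∇f(w₀)‖`. -/
def lipConst {d m : ℕ} (F : Fin m → Vec d → ℝ) (K L : Fin m → ℝ) (w0 : Vec d) : ℝ :=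
  (mean K) ^ 2 + mean L * ‖gradient (objective F) w0‖

/-- The rate of Case 1*; `L0` stands for `L(w₀)`. -/
def tau1 {m : ℕ} (ρ θ L0 : ℝ) (K γloc ε1 : Fin m → ℝ) : ℝ :=
  2 * (1 - ρ) * ((mean fun i => (γloc i + ε1 i * K i) / γloc i ^ 2)⁻¹) ^ 2 * θ / L0

/-- The constant `c` of Case 2*. -/
def c2 {m : ℕ} (φ : ℝ) (K ε2 : Fin m → ℝ) : ℝ :=
  1 / φ * (1 + mean fun i => ε2 i * ((K i ^ 2 + φ ^ 2) / φ ^ 2))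

/-- The rate of Case 2*. -/
def tau2 {m : ℕ} (ρ θ φ L0 : ℝ) (K ε2 : Fin m → ℝ) : ℝ :=
  2 * (1 - ρ) * θ / (L0 * c2 φ K ε2 ^ 2)

/-- The constant `c` of Case 3*. -/
def c3 {m : ℕ} (θ φ γ ν : ℝ) (K ε2 ε3 : Fin m → ℝ) : ℝ :=
  1 / φ * (1 + mean fun i => ε2 i * ((K i ^ 2 + φ ^ 2) / φ ^ 2)) +
    mean fun i =>
      (1 + ε3 i * ((K i ^ 2 + φ ^ 2) / φ ^ 2)) /
          (1 - ε3 i * Real.sqrt ((K i ^ 2 + φ ^ 2) / φ ^ 2)) *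
        (1 / φ * (1 + ε2 i * ((K i ^ 2 + φ ^ 2) / φ ^ 2)) + θ / (γ * Real.sqrt ν)) *
        Real.sqrt ((K i ^ 2 + φ ^ 2) / φ ^ 2)

/-- The rate of Case 3*. -/
def tau3 {m : ℕ} (ρ θ φ γ ν L0 : ℝ) (K ε2 ε3 : Fin m → ℝ) : ℝ :=
  2 * (1 - ρ) * θ / (L0 * c3 θ φ γ ν K ε2 ε3 ^ 2)

/-- The overall rate, the minimum of the three. -/
def tau {m : ℕ} (ρ θ φ γ ν L0 : ℝ) (K γloc ε1 ε2 ε3 : Fin m → ℝ) : ℝ :=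
  min (tau1 ρ θ L0 K γloc ε1) (min (tau2 ρ θ φ L0 K ε2) (tau3 ρ θ φ γ ν L0 K ε2 ε3))

end DINGO

end

/-!
Let `g = ∇f(w_t)`, `H = ∇²f(w_t)` and let `p` be the direction used at iteration `t`.

Since `H(x) ∇f(x) - H(w) ∇f(w) = H(x) (∇f(x) - ∇f(w)) + (H(x) - H(w)) ∇f(w)`, the gradient of
`‖∇f‖² / 2` varies from its value at `w_t` at rate at most `K² + L ‖g‖` (`K`, `L` the averaged
constants), which is at most `M = L(w₀)` as long as the gradient norms have not increased. Hence
`‖∇f(w_t + α p)‖² ≤ ‖g‖² + 2 α ⟪p, H g⟫ + α² M ‖p‖²` for `α ≥ 0` (`norm_gradient_sq_le`).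

Each case yields `⟪p, H g⟫ ≤ -θ ‖g‖²` (`inner_direction_le`) and `‖p‖ ≤ c ‖g‖` with `c` the constant
of that case (`norm_direction_le`). The vectors `v¹` and `v²` are bounded by coercivity of `H_i` on
its range and of the regularized normal matrix; for `v³` the point is the angle estimate
`norm_mul_norm_le_of_approx_normalMap`, used together with `γ √ν ‖g‖ ≤ ‖H g‖` (`norm_gradient_le`).

With these bounds every `α ≤ τ = 2 (1 - ρ) θ / (M c²)` in `(0, 1]` passes the line search, which gives
the rate if `τ ≤ 1`. The remaining case `τ > 1` is not excluded by the assumptions. There the step `1`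
is taken, and the quadratic bound at `α = 1` gives the rate provided that `A = M c²` lies between the
roots `2 ρ θ` and `2 (1 - ρ) θ` of `A² - 2 θ A + 4 ρ (1 - ρ) θ²`. For this it is enough that `A ≥ θ`
and `A < 2 (1 - ρ) θ`. Cauchy-Schwarz on `⟪p, H g⟫` gives `A ≥ θ²`. Replacing `c` by its maximum with
the constant of the first case, whose rate also enters the minimum, gives `A ≥ 1`, since
`γ_i ≤ K_i`; so `A ≥ max 1 θ² ≥ θ` (`lineSearch_decrease`).
-/

namespace DINGO

/-! ### Averages over the workers -/

theorem mean_mono {m : ℕ} {a b : Fin m → ℝ} (h : ∀ i, a i ≤ b i) : mean a ≤ mean b := by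
  unfold mean
  gcongr with i
  exact h i

theorem mean_pos {m : ℕ} (hm : 0 < m) {a : Fin m → ℝ} (h : ∀ i, 0 < a i) : 0 < mean a := by
  have : Nonempty (Fin m) := ⟨⟨0, hm⟩⟩
  exact mul_pos (by positivity) (Finset.sum_pos (fun i _ => h i) Finset.univ_nonempty)

theorem mean_const {m : ℕ} (hm : 0 < m) (c : ℝ) : (mean fun _ : Fin m => c) = c := by
  have : (m : ℝ) ≠ 0 := by positivity
  simp [mean, this]

theorem mean_add {m : ℕ} (a b : Fin m → ℝ) : (mean fun i => a i + b i) = mean a + mean b := by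
  simp [mean, Finset.sum_add_distrib, mul_add]

theorem mean_mul_right {m : ℕ} (a : Fin m → ℝ) (c : ℝ) : (mean fun i => a i * c) = mean a * c := by
  simp [mean, ← Finset.sum_mul, mul_assoc]

theorem mean_mul_left {m : ℕ} (c : ℝ) (a : Fin m → ℝ) : (mean fun i => c * a i) = c * mean a := by
  simp only [mean, ← Finset.mul_sum]
  ring

theorem norm_avg_le {d m : ℕ} (v : Fin m → Vec d) : ‖avg v‖ ≤ mean fun i => ‖v i‖ := by
  unfold avg mean
  rw [norm_smul, Real.norm_of_nonneg (by positivity)]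
  gcongr
  exact norm_sum_le _ _

theorem inner_avg_left {d m : ℕ} (v : Fin m → Vec d) (b : Vec d) :
    inner ℝ (avg v) b = mean fun i => inner ℝ (v i) b := by
  simp [avg, mean, real_inner_smul_left, sum_inner]

theorem avg_neg {d m : ℕ} (v : Fin m → Vec d) : (avg fun i => -v i) = -avg v := by
  simp [avg]

/-- A form of the inequality between the harmonic and the arithmetic mean. -/
theorem one_le_mean_mul_mean {m : ℕ} (hm : 0 < m) {a b : Fin m → ℝ} (ha : ∀ i, 0 ≤ a i)
    (hb : ∀ i, 0 ≤ b i) (hab : ∀ i, 1 ≤ a i * b i) : 1 ≤ mean a * mean b := by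
  have h := Finset.sum_sq_le_sum_mul_sum_of_sq_le_mul Finset.univ (r := fun _ => (1 : ℝ))
    (f := a) (g := b) (fun i _ => ha i) (fun i _ => hb i) (fun i _ => by simpa using hab i)
  have hm' : (0 : ℝ) < m := by exact_mod_cast hm
  simp only [Finset.sum_const, Finset.card_univ, Fintype.card_fin, nsmul_eq_mul, mul_one] at h
  calc (1 : ℝ) = ((m : ℝ)⁻¹) ^ 2 * (m : ℝ) ^ 2 := by field_simp
    _ ≤ ((m : ℝ)⁻¹) ^ 2 * ((∑ i, a i) * ∑ i, b i) := by gcongr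
    _ = mean a * mean b := by unfold mean; ring

/-! ### Gradient and Hessian of the objective -/

theorem gradient_objective {d m : ℕ} {F : Fin m → Vec d → ℝ} (hF : ∀ i, Differentiable ℝ (F i)) :
    gradient (objective F) = fun w => avg fun i => gradient (F i) w := by
  refine gradient_eq fun w => ?_
  rw [hasGradientAt_iff_hasFDerivAt]
  have h : HasFDerivAt (fun w => (m : ℝ)⁻¹ • ∑ i, F i w) ((m : ℝ)⁻¹ • ∑ i, fderiv ℝ (F i) w) w :=
    (HasFDerivAt.fun_sum fun i _ => (hF i w).hasFDerivAt).fun_const_smul _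
  convert! h using 1
  simp [avg, map_sum]

theorem hasFDerivAt_gradient_objective {d m : ℕ} {F : Fin m → Vec d → ℝ}
    (hF : ∀ i, Differentiable ℝ (F i)) (hF' : ∀ i, Differentiable ℝ (gradient (F i))) (w : Vec d) :
    HasFDerivAt (gradient (objective F)) ((m : ℝ)⁻¹ • ∑ i, hess (F i) w) w := by
  rw [gradient_objective hF]
  have h : HasFDerivAt (fun w => ∑ i, gradient (F i) w) (∑ i, hess (F i) w) w :=
    HasFDerivAt.fun_sum fun i _ => (hF' i w).hasFDerivAt
  exact h.fun_const_smul _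

theorem hess_objective {d m : ℕ} {F : Fin m → Vec d → ℝ}
    (hF : ∀ i, Differentiable ℝ (F i)) (hF' : ∀ i, Differentiable ℝ (gradient (F i))) (w : Vec d) :
    hess (objective F) w = (m : ℝ)⁻¹ • ∑ i, hess (F i) w :=
  (hasFDerivAt_gradient_objective hF hF' w).fderiv

theorem differentiable_objective {d m : ℕ} {F : Fin m → Vec d → ℝ}
    (hF : ∀ i, Differentiable ℝ (F i)) : Differentiable ℝ (objective F) := by
  unfold objective mean
  fun_prop

theorem inner_hess_symm {d : ℕ} {f : Vec d → ℝ} (hf : Differentiable ℝ f)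
    (hf' : Differentiable ℝ (gradient f)) (w u v : Vec d) :
    inner ℝ (hess f w u) v = inner ℝ u (hess f w v) := by
  have h1 : ∀ y, HasFDerivAt f (innerSL ℝ (gradient f y)) y := fun y => by
    have := (hf y).hasGradientAt.hasFDerivAt
    exact this
  have h2 : HasFDerivAt (fun y => innerSL ℝ (gradient f y))
      ((innerSL ℝ : Vec d →L[ℝ] _) ∘L hess f w) w :=
    (innerSL ℝ : Vec d →L[ℝ] _).hasFDerivAt.comp w (hf' w).hasFDerivAt
  have := second_derivative_symmetric h1 h2 u v
  have h3 : inner ℝ (hess f w u) v = inner ℝ (hess f w v) u := this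
  rw [h3, real_inner_comm]

theorem norm_hess_le {d : ℕ} {f : Vec d → ℝ} {K : ℝ} (hK : 0 ≤ K)
    (h : ∀ x y, ‖gradient f x - gradient f y‖ ≤ K * ‖x - y‖) (w : Vec d) : ‖hess f w‖ ≤ K := by
  have : LipschitzWith K.toNNReal (gradient f) :=
    LipschitzWith.of_dist_le_mul fun x y => by
      simpa [dist_eq_norm, Real.coe_toNNReal _ hK] using h x y
  simpa [hess, Real.coe_toNNReal _ hK] using norm_fderiv_le_of_lipschitz ℝ (x₀ := w) this

theorem norm_gradient_objective_sub_le {d m : ℕ} {F : Fin m → Vec d → ℝ} {K L : Fin m → ℝ}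
    (h : LocalLipschitz F K L) (x y : Vec d) :
    ‖gradient (objective F) x - gradient (objective F) y‖ ≤ mean K * ‖x - y‖ := by
  rw [gradient_objective fun i => (h i).1]
  have e : (avg fun i => gradient (F i) x) - (avg fun i => gradient (F i) y) =
      avg fun i => gradient (F i) x - gradient (F i) y := by
    simp [avg, smul_sub]
  rw [e, ← mean_mul_right]
  exact (norm_avg_le _).trans (mean_mono fun i => ((h i).2.2.2.2 x y).1)

theorem norm_hess_objective_sub_le {d m : ℕ} {F : Fin m → Vec d → ℝ} {K L : Fin m → ℝ}
    (h : LocalLipschitz F K L) (x y : Vec d) :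
    ‖hess (objective F) x - hess (objective F) y‖ ≤ mean L * ‖x - y‖ := by
  have h1 := fun i => (h i).1
  have h2 := fun i => (h i).2.1
  rw [hess_objective h1 h2, hess_objective h1 h2, ← mean_mul_right,
    ← smul_sub (m : ℝ)⁻¹ (∑ i, hess (F i) x) (∑ i, hess (F i) y), ← Finset.sum_sub_distrib, norm_smul, Real.norm_of_nonneg (by positivity)]
  unfold mean
  gcongr
  exact norm_sum_le_of_le _ fun i _ => ((h i).2.2.2.2 x y).2

/-- Along a ray from `w`, the squared gradient norm lies below the quadratic with the same value
and slope at `w` and curvature `2 (K² + L ‖∇f(w)‖)`. Only the gradient norm at the base point `w`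
enters, since `H(x) ∇f(x) - H(w) ∇f(w) = H(x) (∇f(x) - ∇f(w)) + (H(x) - H(w)) ∇f(w)`. -/
theorem norm_gradient_sq_le {d : ℕ} {f : Vec d → ℝ} {K L : ℝ} (hK : 0 ≤ K)
    (hf : Differentiable ℝ f) (hf' : Differentiable ℝ (gradient f))
    (hg : ∀ x y, ‖gradient f x - gradient f y‖ ≤ K * ‖x - y‖)
    (hH : ∀ x y, ‖hess f x - hess f y‖ ≤ L * ‖x - y‖) (w p : Vec d) {α : ℝ} (hα : 0 ≤ α) :
    ‖gradient f (w + α • p)‖ ^ 2 ≤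
      ‖gradient f w‖ ^ 2 + 2 * α * inner ℝ p (hess f w (gradient f w)) +
        α ^ 2 * ((K ^ 2 + L * ‖gradient f w‖) * ‖p‖ ^ 2) := by
  set M := (K ^ 2 + L * ‖gradient f w‖) with hM
  set q := inner ℝ p (hess f w (gradient f w)) with hq
  have hder : ∀ s : ℝ, HasDerivAt
      (fun s => ‖gradient f (w + s • p)‖ ^ 2 - (‖gradient f w‖ ^ 2 + 2 * s * q +
        s ^ 2 * (M * ‖p‖ ^ 2)))
      (2 * inner ℝ p (hess f (w + s • p) (gradient f (w + s • p))) -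
        (2 * q + 2 * s * (M * ‖p‖ ^ 2))) s := by
    intro s
    have hl : HasDerivAt (fun s : ℝ => w + s • p) p s := by
      simpa using ((hasDerivAt_id s).smul_const p).const_add w
    have h1 : HasDerivAt (fun s : ℝ => gradient f (w + s • p)) (hess f (w + s • p) p) s := by
      have := (hf' (w + s • p)).hasFDerivAt.comp_hasDerivAt s hl
      exact this
    have h2 := h1.norm_sq
    have h3 : HasDerivAt (fun s : ℝ => ‖gradient f w‖ ^ 2 + 2 * s * q + s ^ 2 * (M * ‖p‖ ^ 2))
        (2 * q + 2 * s * (M * ‖p‖ ^ 2)) s := by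
      have := ((((hasDerivAt_id s).const_mul 2).mul_const q).const_add (‖gradient f w‖ ^ 2)).add
        (((hasDerivAt_id s).pow 2).mul_const (M * ‖p‖ ^ 2))
      simpa [Pi.add_def] using this
    have h4 := h2.sub h3
    rw [← inner_hess_symm hf hf', real_inner_comm]
    exact h4
  have hneg : ∀ s, 0 ≤ s → 2 * inner ℝ p (hess f (w + s • p) (gradient f (w + s • p))) -
        (2 * q + 2 * s * (M * ‖p‖ ^ 2)) ≤ 0 := by
    intro s hs
    set x := w + s • p with hx
    have hxw : ‖x - w‖ = s * ‖p‖ := by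
      simp [hx, norm_smul, abs_of_nonneg hs]
    have hsplit : hess f x (gradient f x) - hess f w (gradient f w) =
        hess f x (gradient f x - gradient f w) + (hess f x - hess f w) (gradient f w) := by
      simp
    have hn : ‖hess f x (gradient f x) - hess f w (gradient f w)‖ ≤ M * (s * ‖p‖) := by
      rw [hsplit]
      calc _ ≤ K * (K * (s * ‖p‖)) + L * (s * ‖p‖) * ‖gradient f w‖ := by
            refine (norm_add_le _ _).trans (add_le_add ?_ ?_)
            · refine ((hess f x).le_of_opNorm_le (norm_hess_le hK hg x) _).trans ?_
              gcongr
              exact hxw ▸ hg x w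
            · exact (hess f x - hess f w).le_of_opNorm_le (hxw ▸ hH x w) _
        _ = M * (s * ‖p‖) := by rw [hM]; ring
    have hi : inner ℝ p (hess f x (gradient f x)) - q ≤ ‖p‖ * (M * (s * ‖p‖)) := by
      rw [hq, ← inner_sub_right]
      exact (real_inner_le_norm _ _).trans (by gcongr)
    linarith
  have hanti := antitoneOn_of_deriv_nonpos (convex_Ici (0 : ℝ))
    (fun s _ => (hder s).continuousAt.continuousWithinAt)
    (fun s _ => (hder s).differentiableAt.differentiableWithinAt)
    (fun s hs => by
      rw [interior_Ici] at hs
      rw [(hder s).deriv]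
      exact hneg s (le_of_lt hs))
  have := hanti (Set.mem_Ici.2 le_rfl) (Set.mem_Ici.2 hα) hα
  simp at this
  linarith

/-! ### The line search -/

theorem isGreatest_stepSize {d : ℕ} {f : Vec d → ℝ} (hf' : Continuous (gradient f)) {ρ : ℝ}
    {w p : Vec d} (hne : (lineSearchSet f ρ w p).Nonempty) :
    IsGreatest (lineSearchSet f ρ w p) (stepSize f ρ w p) := by
  have hbdd : BddAbove (lineSearchSet f ρ w p) := ⟨1, fun a ha => ha.2.1⟩
  obtain ⟨a, ha⟩ := hne
  have hclosed : IsClosed {α : ℝ | α ≤ 1 ∧ ‖gradient f (w + α • p)‖ ^ 2 ≤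
      ‖gradient f w‖ ^ 2 + 2 * α * ρ * inner ℝ p (hess f w (gradient f w))} :=
    have h1 : Continuous fun α : ℝ => ‖gradient f (w + α • p)‖ ^ 2 := by fun_prop
    have h2 : Continuous fun α : ℝ => ‖gradient f w‖ ^ 2 +
        2 * α * ρ * inner ℝ p (hess f w (gradient f w)) := by fun_prop
    (isClosed_le continuous_id continuous_const).inter (isClosed_le h1 h2)
  have hmem := hclosed.closure_subset_iff.2 (fun α (hα : α ∈ lineSearchSet f ρ w p) => hα.2)
    (csSup_mem_closure ⟨a, ha⟩ hbdd)
  exact ⟨⟨ha.1.trans_le (le_csSup hbdd ha), hmem⟩, fun b hb => le_csSup hbdd hb⟩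

/-- The line search along a direction with slope at most `-θ ‖g‖²` and relative length at most `C`.
The step `2 (1 - ρ) θ / (M C²)` passes if it does not exceed `1`. Otherwise the step `1` is taken,
and the quadratic upper bound at `1` gives the same rate, because `M C² ≥ max 1 θ² ≥ θ`. -/
theorem lineSearch_decrease {d : ℕ} {f : Vec d → ℝ} (hf' : Continuous (gradient f))
    {ρ θ M C τ : ℝ} {w p : Vec d} (hθ : 0 < θ) (hρ0 : 0 < ρ) (hρ1 : ρ < 1)
    (hM : 0 < M) (hg : 0 < ‖gradient f w‖)
    (hquad : ∀ α : ℝ, 0 ≤ α → ‖gradient f (w + α • p)‖ ^ 2 ≤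
      ‖gradient f w‖ ^ 2 + 2 * α * inner ℝ p (hess f w (gradient f w)) + α ^ 2 * (M * ‖p‖ ^ 2))
    (hslope : inner ℝ p (hess f w (gradient f w)) ≤ -(θ * ‖gradient f w‖ ^ 2))
    (hp : ‖p‖ ≤ C * ‖gradient f w‖) (hC1 : 1 ≤ M * C ^ 2) (hCθ : θ ^ 2 ≤ M * C ^ 2)
    (hτ : τ ≤ 2 * (1 - ρ) * θ / (M * C ^ 2)) :
    IsGreatest (lineSearchSet f ρ w p) (stepSize f ρ w p) ∧
      ‖gradient f (w + stepSize f ρ w p • p)‖ ^ 2 ≤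
        (1 - 2 * τ * ρ * θ) * ‖gradient f w‖ ^ 2 := by
  set G := ‖gradient f w‖ ^ 2 with hG
  have hG0 : 0 < G := by positivity
  set q := inner ℝ p (hess f w (gradient f w)) with hq
  set A := M * C ^ 2 with hA
  have hA0 : 0 < A := by linarith
  have hAθ : θ ≤ A := by
    by_contra! h
    nlinarith
  have hMp : M * ‖p‖ ^ 2 ≤ A * G := by
    have : ‖p‖ ^ 2 ≤ (C * ‖gradient f w‖) ^ 2 := by gcongr
    calc M * ‖p‖ ^ 2 ≤ M * (C * ‖gradient f w‖) ^ 2 := by gcongr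
      _ = A * G := by rw [hA, hG]; ring
  have hτA : τ * A ≤ 2 * (1 - ρ) * θ := by rwa [le_div_iff₀ hA0] at hτ
  have hpass : ∀ α, 0 < α → α ≤ 1 → α * A ≤ 2 * (1 - ρ) * θ → α ∈ lineSearchSet f ρ w p := by
    intro α h0 h1 h2
    refine ⟨h0, h1, (hquad α h0.le).trans ?_⟩
    have h3 : α * (M * ‖p‖ ^ 2) ≤ 2 * (1 - ρ) * (-q) := by
      calc α * (M * ‖p‖ ^ 2) ≤ α * (A * G) := by gcongr
        _ = α * A * G := by ring
        _ ≤ 2 * (1 - ρ) * θ * G := by gcongr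
        _ = 2 * (1 - ρ) * (θ * G) := by ring
        _ ≤ _ := mul_le_mul_of_nonneg_left (by linarith) (by linarith)
    nlinarith [mul_le_mul_of_nonneg_left h3 h0.le]
  have h1ρ : 0 < 1 - ρ := by linarith
  rcases le_or_gt A (2 * (1 - ρ) * θ) with hle | hgt
  · have h1 := hpass 1 one_pos le_rfl (by linarith)
    have hgr := isGreatest_stepSize hf' ⟨1, h1⟩
    have hs : stepSize f ρ w p = 1 := le_antisymm hgr.1.2.1 (hgr.2 h1)
    refine ⟨hgr, ?_⟩
    rw [hs]
    refine (hquad 1 zero_le_one).trans ?_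
    -- `A` lies between the roots `2 ρ θ` and `2 (1 - ρ) θ` of `A² - 2 θ A + 4 ρ (1 - ρ) θ²`.
    have hroot : 2 * ρ * θ ≤ A := by nlinarith
    have hkey : 2 * τ * ρ * θ ≤ 2 * θ - A := by
      refine le_of_mul_le_mul_right ?_ hA0
      nlinarith [mul_nonneg (sub_nonneg.2 hroot) (sub_nonneg.2 hle),
        mul_le_mul_of_nonneg_left hτA (by positivity : 0 ≤ 2 * ρ * θ)]
    nlinarith [mul_le_mul_of_nonneg_right hkey hG0.le]
  · have hτ0 : 0 < 2 * (1 - ρ) * θ / A := by positivity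
    have hmem := hpass _ hτ0 ((div_le_one hA0).2 hgt.le) (div_mul_cancel₀ _ hA0.ne').le
    have hgr := isGreatest_stepSize hf' ⟨_, hmem⟩
    refine ⟨hgr, hgr.1.2.2.trans ?_⟩
    have hτs : τ ≤ stepSize f ρ w p := hτ.trans (hgr.2 hmem)
    set s := stepSize f ρ w p
    have hs0 : 0 < s := hgr.1.1
    calc G + 2 * s * ρ * q ≤ G + 2 * s * ρ * (-(θ * G)) := by gcongr
      _ = G - 2 * ρ * θ * G * s := by ring
      _ ≤ G - 2 * ρ * θ * G * τ := by gcongr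
      _ = (1 - 2 * τ * ρ * θ) * G := by ring

/-! ### The regularized normal matrix -/

theorem inner_normalMap {d : ℕ} (φ : ℝ) (H : Vec d →L[ℝ] Vec d) (u v : Vec d) :
    inner ℝ (normalMap φ H u) v = inner ℝ (H u) (H v) + φ ^ 2 * inner ℝ u v := by
  rw [normalMap, ContinuousLinearMap.comp_apply, ContinuousLinearMap.adjoint_inner_left]
  simp [stacked, WithLp.prod_inner_apply, real_inner_smul_left, real_inner_smul_right]
  ring

theorem norm_stacked_sq {d : ℕ} (φ : ℝ) (H : Vec d →L[ℝ] Vec d) (u : Vec d) :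
    ‖stacked φ H u‖ ^ 2 = ‖H u‖ ^ 2 + φ ^ 2 * ‖u‖ ^ 2 := by
  simp [stacked, WithLp.prod_norm_sq_eq_of_L2, norm_smul, mul_pow]

theorem inner_normalMap_eq_inner_stacked {d : ℕ} (φ : ℝ) (H : Vec d →L[ℝ] Vec d) (u v : Vec d) :
    inner ℝ (normalMap φ H u) v = inner ℝ (stacked φ H u) (stacked φ H v) := by
  rw [normalMap, ContinuousLinearMap.comp_apply, ContinuousLinearMap.adjoint_inner_left]

theorem mul_norm_le_norm_stacked {d : ℕ} (φ : ℝ) (H : Vec d →L[ℝ] Vec d)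
    (u : Vec d) : φ * ‖u‖ ≤ ‖stacked φ H u‖ := by
  refine le_of_sq_le_sq ?_ (norm_nonneg _)
  rw [norm_stacked_sq, mul_pow]
  linarith [sq_nonneg ‖H u‖]

theorem norm_stacked_le {d : ℕ} (φ : ℝ) {K : ℝ} {H : Vec d →L[ℝ] Vec d}
    (hH : ‖H‖ ≤ K) : ‖stacked φ H‖ ≤ √(K ^ 2 + φ ^ 2) := by
  refine ContinuousLinearMap.opNorm_le_bound _ (Real.sqrt_nonneg _) fun u => ?_
  refine le_of_sq_le_sq ?_ (by positivity)
  rw [norm_stacked_sq, mul_pow, Real.sq_sqrt (by positivity)]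
  have : ‖H u‖ ^ 2 ≤ (K * ‖u‖) ^ 2 := by
    gcongr
    exact H.le_of_opNorm_le hH u
  linarith

theorem surjective_normalMap {d : ℕ} {φ : ℝ} (hφ : 0 < φ) (H : Vec d →L[ℝ] Vec d) :
    Function.Surjective (normalMap φ H) := by
  refine (LinearMap.injective_iff_surjective (f := (normalMap φ H : Vec d →ₗ[ℝ] Vec d))).1 ?_
  refine (injective_iff_map_eq_zero _).2 fun u hu => ?_
  have h := inner_normalMap φ H u u
  have hu' : normalMap φ H u = 0 := hu
  rw [hu', inner_zero_left, real_inner_self_eq_norm_sq, real_inner_self_eq_norm_sq] at h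
  have : φ ^ 2 * ‖u‖ ^ 2 ≤ 0 := by linarith [sq_nonneg ‖H u‖]
  have : ‖u‖ ^ 2 ≤ 0 := nonpos_of_mul_nonpos_right this (by positivity)
  simpa using le_antisymm this (sq_nonneg _)

/-- If `B = [H; φ I]ᵀ [H; φ I]` and `B y = r`, then `‖[H; φ I] y‖ ≤ ‖r‖ / φ`. -/
theorem mul_norm_stacked_le {d : ℕ} {φ : ℝ} (hφ : 0 < φ) (H : Vec d →L[ℝ] Vec d) (y : Vec d) :
    φ * ‖stacked φ H y‖ ≤ ‖normalMap φ H y‖ := by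
  rcases (norm_nonneg (stacked φ H y)).eq_or_lt with h0 | h0
  · rw [← h0, mul_zero]
    exact norm_nonneg _
  refine le_of_mul_le_mul_right ?_ h0
  calc φ * ‖stacked φ H y‖ * ‖stacked φ H y‖ = φ * ‖stacked φ H y‖ ^ 2 := by ring
    _ = φ * inner ℝ (normalMap φ H y) y := by
      rw [inner_normalMap_eq_inner_stacked, real_inner_self_eq_norm_sq]
    _ ≤ φ * (‖normalMap φ H y‖ * ‖y‖) := by gcongr; exact real_inner_le_norm _ _
    _ = ‖normalMap φ H y‖ * (φ * ‖y‖) := by ring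
    _ ≤ ‖normalMap φ H y‖ * ‖stacked φ H y‖ := by
      gcongr
      exact mul_norm_le_norm_stacked φ H y

/-! ### Lengths of the vectors supplied by the workers -/

theorem apply_starProjection_range {d : ℕ} {H : Vec d →L[ℝ] Vec d}
    (hs : ∀ u v, inner ℝ (H u) v = inner ℝ u (H v)) (g : Vec d) :
    H (H.range.starProjection g) = H g := by
  have h := Submodule.sub_starProjection_mem_orthogonal (K := H.range) g
  have h0 : H (g - H.range.starProjection g) = 0 := by
    rw [← inner_self_eq_zero (𝕜 := ℝ), hs]
    exact Submodule.inner_left_of_mem_orthogonal (LinearMap.mem_range_self _ _) h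
  rw [map_sub, sub_eq_zero] at h0
  exact h0.symm

/-- The length of an approximate solution `v ∈ range H` of `H² v = H g`. The error `H v - P g`, with
`P` the projection onto the range, lies in the range and is mapped by `H` to the residual. -/
theorem norm_le_of_approx_pinv {d : ℕ} {H : Vec d →L[ℝ] Vec d} {γ K ε : ℝ} {g v : Vec d}
    (hs : ∀ u v, inner ℝ (H u) v = inner ℝ u (H v)) (hK : ‖H‖ ≤ K) (hγ : 0 < γ) (hε : 0 ≤ ε)
    (hreg : ∀ p ∈ H.range, γ * ‖p‖ ≤ ‖H p‖) (hv : ‖H (H v) - H g‖ ≤ ε * ‖H g‖)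
    (hvr : v ∈ H.range) : ‖v‖ ≤ (γ + ε * K) / γ ^ 2 * ‖g‖ := by
  set P := H.range.starProjection with hP
  have h1 : γ * ‖H v - P g‖ ≤ ε * (K * ‖g‖) := by
    have hmem : H v - P g ∈ H.range :=
      Submodule.sub_mem _ (LinearMap.mem_range_self _ _) (Submodule.starProjection_apply_mem _ _)
    refine (hreg _ hmem).trans ?_
    rw [map_sub, hP, apply_starProjection_range hs]
    refine hv.trans ?_
    gcongr
    exact H.le_of_opNorm_le hK g
  have h2 : γ * ‖v‖ ≤ ‖H v - P g‖ + ‖g‖ := by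
    refine (hreg v hvr).trans ?_
    calc ‖H v‖ = ‖(H v - P g) + P g‖ := by simp
      _ ≤ ‖H v - P g‖ + ‖P g‖ := norm_add_le _ _
      _ ≤ _ := by gcongr; exact Submodule.norm_starProjection_apply_le _ _
  rw [div_mul_eq_mul_div, le_div_iff₀ (by positivity)]
  nlinarith [mul_le_mul_of_nonneg_left h2 hγ.le]

/-- The length of an approximate solution `v` of `(H² + φ² I) v = H g`, for symmetric `H`. -/
theorem norm_le_of_approx_normalMap {d : ℕ} {H : Vec d →L[ℝ] Vec d} {φ K ε : ℝ} {g v : Vec d}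
    (hs : ∀ u v, inner ℝ (H u) v = inner ℝ u (H v)) (hK : ‖H‖ ≤ K) (hφ : 0 < φ) (hε : 0 ≤ ε)
    (hv : ‖normalMap φ H v - H g‖ ≤ ε * ‖H g‖) :
    ‖v‖ ≤ 1 / φ * (1 + ε * ((K ^ 2 + φ ^ 2) / φ ^ 2)) * ‖g‖ := by
  have hK0 : 0 ≤ K := (norm_nonneg _).trans hK
  have h1 : ‖H v‖ ^ 2 + φ ^ 2 * ‖v‖ ^ 2 ≤ ‖g‖ * ‖H v‖ + ε * (K * ‖g‖) * ‖v‖ := by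
    calc ‖H v‖ ^ 2 + φ ^ 2 * ‖v‖ ^ 2 = inner ℝ (normalMap φ H v) v := by
          rw [inner_normalMap, real_inner_self_eq_norm_sq, real_inner_self_eq_norm_sq]
      _ = inner ℝ g (H v) + inner ℝ (normalMap φ H v - H g) v := by
          rw [inner_sub_left, hs g v]; ring
      _ ≤ ‖g‖ * ‖H v‖ + ‖normalMap φ H v - H g‖ * ‖v‖ :=
          add_le_add (real_inner_le_norm _ _) (real_inner_le_norm _ _)
      _ ≤ _ := by
          gcongr
          exact hv.trans (by gcongr; exact H.le_of_opNorm_le hK g)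
  have h2 : φ ^ 2 * ‖v‖ ^ 2 ≤ ‖g‖ ^ 2 + ε * (K * ‖g‖) * ‖v‖ := by
    nlinarith [sq_nonneg (‖H v‖ - ‖g‖ / 2), sq_nonneg ‖g‖]
  have h3 : φ * ‖v‖ ≤ ‖g‖ + ε * (K * ‖g‖) / φ := by
    by_contra! h
    have hb : 0 ≤ ε * (K * ‖g‖) / φ := by positivity
    have hgv : ‖g‖ ≤ φ * ‖v‖ := by linarith
    have e : ε * (K * ‖g‖) = φ * (ε * (K * ‖g‖) / φ) := by field_simp
    rw [e] at h2
    nlinarith [norm_nonneg g, norm_nonneg v]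
  have h4 : ε * (K * ‖g‖) / φ ≤ ε * ((K ^ 2 + φ ^ 2) / φ ^ 2) * ‖g‖ := by
    have : K / φ ≤ (K ^ 2 + φ ^ 2) / φ ^ 2 := by
      rw [div_le_div_iff₀ hφ (by positivity)]
      nlinarith [mul_nonneg hφ.le (add_nonneg (sq_nonneg (K - φ)) (mul_nonneg hK0 hφ.le))]
    calc _ = ε * (K / φ) * ‖g‖ := by ring
      _ ≤ _ := by gcongr
  calc ‖v‖ = 1 / φ * (φ * ‖v‖) := by field_simp
    _ ≤ 1 / φ * (‖g‖ + ε * ((K ^ 2 + φ ^ 2) / φ ^ 2) * ‖g‖) := by gcongr; linarith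
    _ = _ := by ring

/-- For an approximate solution `v` of `(HᵀH + φ² I) v = b`, the angle between `v` and `b` is bounded
away from `π / 2`. With `S = [H; φ I]`, `B = SᵀS`, `B x = b`, one has `⟪v, b⟫ = ⟪S v, S x⟫`, and both
`S v - S x` and `v` are controlled by `‖S x‖`. -/
theorem norm_mul_norm_le_of_approx_normalMap {d : ℕ} {H : Vec d →L[ℝ] Vec d} {φ K ε : ℝ}
    {b v : Vec d} (hK : ‖H‖ ≤ K) (hφ : 0 < φ) (hε : 0 ≤ ε)
    (hεκ : ε * √((K ^ 2 + φ ^ 2) / φ ^ 2) < 1) (hv : ‖normalMap φ H v - b‖ ≤ ε * ‖b‖) :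
    ‖b‖ * ‖v‖ ≤ (1 + ε * ((K ^ 2 + φ ^ 2) / φ ^ 2)) / (1 - ε * √((K ^ 2 + φ ^ 2) / φ ^ 2)) *
      √((K ^ 2 + φ ^ 2) / φ ^ 2) * inner ℝ v b := by
  have hK0 : 0 ≤ K := (norm_nonneg _).trans hK
  set κ := (K ^ 2 + φ ^ 2) / φ ^ 2 with hκ
  have hκ1 : 1 ≤ κ := by
    rw [hκ, one_le_div (by positivity)]
    nlinarith
  have hsκ1 : 1 ≤ √κ := Real.one_le_sqrt.2 hκ1
  have hsκ : √κ * φ = √(K ^ 2 + φ ^ 2) := by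
    rw [hκ, Real.sqrt_div (by positivity), Real.sqrt_sq hφ.le]
    field_simp
  have hκs : √κ ≤ κ := by
    nlinarith [Real.sq_sqrt (zero_le_one.trans hκ1)]
  obtain ⟨x, hx⟩ := surjective_normalMap hφ H b
  set S := stacked φ H with hS
  -- `‖b‖ = ‖Sᵀ S x‖` is at most `√(K² + φ²) ‖S x‖`
  have hb : ‖b‖ ≤ √κ * φ * ‖S x‖ := by
    rw [hsκ, ← hx]
    refine (ContinuousLinearMap.adjoint S).le_of_opNorm_le ?_ (S x)
    rw [LinearIsometryEquiv.norm_map]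
    exact norm_stacked_le φ hK
  have hy : ‖S (v - x)‖ ≤ ε * √κ * ‖S x‖ := by
    refine le_of_mul_le_mul_left ?_ hφ
    refine (mul_norm_stacked_le hφ H (v - x)).trans ?_
    rw [map_sub, hx]
    refine hv.trans ?_
    calc ε * ‖b‖ ≤ ε * (√κ * φ * ‖S x‖) := by gcongr
      _ = _ := by ring
  have hvle : φ * ‖v‖ ≤ (1 + ε * κ) * ‖S x‖ := by
    refine (mul_norm_le_norm_stacked φ H v).trans ?_
    calc ‖S v‖ = ‖S x + S (v - x)‖ := by simp
      _ ≤ ‖S x‖ + ε * √κ * ‖S x‖ := (norm_add_le _ _).trans (by gcongr)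
      _ ≤ ‖S x‖ + ε * κ * ‖S x‖ := by gcongr
      _ = _ := by ring
  have hin : (1 - ε * √κ) * ‖S x‖ ^ 2 ≤ inner ℝ v b := by
    have e : inner ℝ v b = ‖S x‖ ^ 2 + inner ℝ (S (v - x)) (S x) := by
      rw [real_inner_comm, ← hx, inner_normalMap_eq_inner_stacked, ← real_inner_self_eq_norm_sq,
        ← inner_add_left, map_sub, add_sub_cancel, real_inner_comm]
    have h1 : -(ε * √κ * ‖S x‖ * ‖S x‖) ≤ inner ℝ (S (v - x)) (S x) := by
      have h2 := (abs_le.1 (abs_real_inner_le_norm (S (v - x)) (S x))).1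
      have h3 := mul_le_mul_of_nonneg_right hy (norm_nonneg (S x))
      linarith
    rw [e]
    linarith
  have hpos : 0 < 1 - ε * √κ := by linarith
  calc ‖b‖ * ‖v‖ ≤ (√κ * φ * ‖S x‖) * ‖v‖ := by gcongr
    _ = √κ * ‖S x‖ * (φ * ‖v‖) := by ring
    _ ≤ √κ * ‖S x‖ * ((1 + ε * κ) * ‖S x‖) := by gcongr
    _ = (1 + ε * κ) / (1 - ε * √κ) * √κ * ((1 - ε * √κ) * ‖S x‖ ^ 2) := by
      rw [div_mul_eq_mul_div, div_mul_eq_mul_div, eq_div_iff hpos.ne']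
      ring
    _ ≤ _ := by gcongr

/-- The gradient is controlled by `H g`, since a fixed share of it lies in the range of `H`. -/
theorem norm_gradient_le {d : ℕ} {h : Vec d → ℝ} {γ ν : ℝ}
    (hs : ∀ w u v, inner ℝ (hess h w u) v = inner ℝ u (hess h w v))
    (hreg : PseudoInverseRegular h γ) (hnull : GradientHessianNullSpace h ν) (w : Vec d) :
    γ * √ν * ‖gradient h w‖ ≤ ‖hess h w (gradient h w)‖ := by
  obtain ⟨hγ, hreg⟩ := hreg
  obtain ⟨hν, -, hnull⟩ := hnull
  set g := gradient h w
  have key : ∀ V : Submodule ℝ (Vec d),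
      ∑ j, (inner ℝ (stdOrthonormalBasis ℝ V j : Vec d) g) ^ 2 = ‖V.starProjection g‖ ^ 2 := by
    intro V
    have e : ‖V.starProjection g‖ = ‖V.orthogonalProjectionOnto g‖ := rfl
    rw [e, ← (stdOrthonormalBasis ℝ V).sum_sq_norm_inner_right]
    simp
  have h1 := hnull w _ _ (stdOrthonormalBasis ℝ (hess h w).range)
    (stdOrthonormalBasis ℝ ((hess h w).range)ᗮ)
  rw [key, key] at h1
  have h2 := Submodule.norm_sq_eq_add_norm_sq_starProjection g (hess h w).range
  set P := (hess h w).range.starProjection g with hP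
  have h3 : (√ν * ‖g‖) ^ 2 ≤ ‖P‖ ^ 2 := by
    rw [mul_pow, Real.sq_sqrt hν.le, h2]
    calc ν * (‖P‖ ^ 2 + _) ≤ ν * (‖P‖ ^ 2 + (1 - ν) / ν * ‖P‖ ^ 2) := by gcongr
      _ = ‖P‖ ^ 2 := by field_simp; ring
  have h4 : √ν * ‖g‖ ≤ ‖P‖ := le_of_sq_le_sq h3 (norm_nonneg _)
  calc γ * √ν * ‖g‖ = γ * (√ν * ‖g‖) := by ring
    _ ≤ γ * ‖P‖ := by gcongr
    _ ≤ ‖hess h w P‖ := hreg w P (Submodule.starProjection_apply_mem _ _)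
    _ = _ := by rw [hP, apply_starProjection_range (hs w)]

/-! ### The update direction -/

theorem inner_case3Local_le {d : ℕ} {θ : ℝ} {g b v2 v3 : Vec d} (h3 : 0 < inner ℝ v3 b) :
    inner ℝ (case3Local θ g b v2 v3) b ≤ -(θ * ‖g‖ ^ 2) := by
  unfold case3Local
  split_ifs with h
  · rw [inner_sub_left, inner_neg_left, real_inner_smul_left, div_mul_cancel₀ _ h3.ne']
    linarith
  · rw [inner_neg_left]
    linarith

theorem inner_direction_le {d m : ℕ} (hm : 0 < m) {θ : ℝ} {g b : Vec d} {v1 v2 v3 : Fin m → Vec d}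
    (h3 : ∀ i, 0 < inner ℝ (v3 i) b) :
    inner ℝ (direction θ g b v1 v2 v3) b ≤ -(θ * ‖g‖ ^ 2) := by
  unfold direction
  split_ifs with h h'
  · rw [avg_neg, inner_neg_left]
    linarith
  · rw [avg_neg, inner_neg_left]
    linarith
  · rw [inner_avg_left, ← mean_const hm (-(θ * ‖g‖ ^ 2))]
    exact mean_mono fun i => inner_case3Local_le (h3 i)

theorem norm_case3Local_le {d : ℕ} {θ μ a s : ℝ} {g b v2 v3 : Vec d} (hθ : 0 ≤ θ) (hμ : 0 < μ)
    (ha : 0 ≤ a) (hs : 0 ≤ s) (hg : μ * ‖g‖ ≤ ‖b‖) (h2 : ‖v2‖ ≤ a * ‖g‖) (h3 : 0 < inner ℝ v3 b)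
    (hv3 : ‖b‖ * ‖v3‖ ≤ s * inner ℝ v3 b) :
    ‖case3Local θ g b v2 v3‖ ≤ (a + s * (a + θ / μ)) * ‖g‖ := by
  have hn : 0 ≤ s * (a + θ / μ) * ‖g‖ := by positivity
  unfold case3Local
  split_ifs with h
  · set N := -inner ℝ v2 b + θ * ‖g‖ ^ 2 with hN
    have hN0 : 0 ≤ N := by linarith
    have hNle : N ≤ (a + θ / μ) * ‖g‖ * ‖b‖ := by
      have h4 : -inner ℝ v2 b ≤ a * ‖g‖ * ‖b‖ :=
        (neg_le_abs _).trans ((abs_real_inner_le_norm _ _).trans (by gcongr))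
      have h5 : θ * ‖g‖ ^ 2 ≤ θ / μ * ‖g‖ * ‖b‖ := by
        calc θ * ‖g‖ ^ 2 = θ / μ * ‖g‖ * (μ * ‖g‖) := by field_simp
          _ ≤ _ := by gcongr
      rw [hN]
      linarith
    have h6 : ‖(N / inner ℝ v3 b) • v3‖ ≤ s * (a + θ / μ) * ‖g‖ := by
      rw [norm_smul, Real.norm_of_nonneg (by positivity), div_mul_eq_mul_div, div_le_iff₀ h3]
      calc N * ‖v3‖ ≤ (a + θ / μ) * ‖g‖ * ‖b‖ * ‖v3‖ := by gcongr
        _ = (a + θ / μ) * ‖g‖ * (‖b‖ * ‖v3‖) := by ring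
        _ ≤ (a + θ / μ) * ‖g‖ * (s * inner ℝ v3 b) := by gcongr
        _ = _ := by ring
    refine (norm_sub_le _ _).trans ?_
    rw [norm_neg]
    linarith
  · rw [norm_neg]
    linarith

theorem norm_avg_le_mean_mul {d m : ℕ} {v : Fin m → Vec d} {a : Fin m → ℝ} {x : ℝ}
    (h : ∀ i, ‖v i‖ ≤ a i * x) : ‖avg v‖ ≤ mean a * x := by
  rw [← mean_mul_right]
  exact (norm_avg_le v).trans (mean_mono h)

theorem c2_eq_mean {m : ℕ} (hm : 0 < m) (φ : ℝ) (K ε2 : Fin m → ℝ) :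
    c2 φ K ε2 = mean fun i => 1 / φ * (1 + ε2 i * ((K i ^ 2 + φ ^ 2) / φ ^ 2)) := by
  rw [mean_mul_left, mean_add, mean_const hm, c2]

/-- The length of the update direction relative to the gradient: one of the three constants,
according to the case. -/
theorem norm_direction_le {d m : ℕ} (hm : 0 < m) {H : Fin m → Vec d →L[ℝ] Vec d} {g b : Vec d}
    {v1 v2 v3 : Fin m → Vec d} {K γloc ε1 ε2 ε3 : Fin m → ℝ} {θ φ γ ν : ℝ}
    (hs : ∀ i u v, inner ℝ (H i u) v = inner ℝ u (H i v)) (hK : ∀ i, ‖H i‖ ≤ K i)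
    (hγloc : ∀ i, 0 < γloc i) (hreg : ∀ i, ∀ p ∈ (H i).range, γloc i * ‖p‖ ≤ ‖H i p‖)
    (hγ : 0 < γ) (hν : 0 < ν) (hg : γ * √ν * ‖g‖ ≤ ‖b‖) (hθ : 0 < θ) (hφ : 0 < φ)
    (hε1 : ∀ i, 0 ≤ ε1 i) (hε2 : ∀ i, 0 ≤ ε2 i) (hε3 : ∀ i, 0 ≤ ε3 i)
    (hε3' : ∀ i, ε3 i < √(φ ^ 2 / (K i ^ 2 + φ ^ 2)))
    (hv1 : ∀ i, ‖H i (H i (v1 i)) - H i g‖ ≤ ε1 i * ‖H i g‖) (hv1r : ∀ i, v1 i ∈ (H i).range)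
    (hv2 : ∀ i, ‖normalMap φ (H i) (v2 i) - H i g‖ ≤ ε2 i * ‖H i g‖)
    (hv3 : ∀ i, ‖normalMap φ (H i) (v3 i) - b‖ ≤ ε3 i * ‖b‖) (hv3p : ∀ i, 0 < inner ℝ (v3 i) b) :
    ‖direction θ g b v1 v2 v3‖ ≤ (mean fun i => (γloc i + ε1 i * K i) / γloc i ^ 2) * ‖g‖ ∨
      ‖direction θ g b v1 v2 v3‖ ≤ c2 φ K ε2 * ‖g‖ ∨
      ‖direction θ g b v1 v2 v3‖ ≤ c3 θ φ γ ν K ε2 ε3 * ‖g‖ := by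
  have hv2n := fun i => norm_le_of_approx_normalMap (hs i) (hK i) hφ (hε2 i) (hv2 i)
  unfold direction
  split_ifs with h h'
  · refine Or.inl (norm_avg_le_mean_mul fun i => ?_)
    rw [norm_neg]
    exact norm_le_of_approx_pinv (hs i) (hK i) (hγloc i) (hε1 i) (hreg i) (hv1 i) (hv1r i)
  · refine Or.inr (Or.inl ?_)
    rw [c2_eq_mean hm]
    refine norm_avg_le_mean_mul fun i => ?_
    rw [norm_neg]
    exact hv2n i
  · refine Or.inr (Or.inr ?_)
    have hc3 : c3 θ φ γ ν K ε2 ε3 = c2 φ K ε2 + _ := rfl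
    rw [hc3, c2_eq_mean hm, ← mean_add]
    refine norm_avg_le_mean_mul fun i => ?_
    have hsq : 0 < √((K i ^ 2 + φ ^ 2) / φ ^ 2) := by positivity
    have hlt : ε3 i * √((K i ^ 2 + φ ^ 2) / φ ^ 2) < 1 := by
      rw [← lt_div_iff₀ hsq, one_div, ← Real.sqrt_inv, inv_div]
      exact hε3' i
    have hpos := sub_pos.2 hlt
    have := hε2 i
    have := hε3 i
    refine (norm_case3Local_le hθ.le (by positivity) (by positivity) (by positivity) hg (hv2n i)
      (hv3p i) (norm_mul_norm_le_of_approx_normalMap (hK i) hφ (hε3 i) hlt (hv3 i))).trans_eq ?_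
    ring

/-! ### The rate -/

theorem Performs.of_succ {d : ℕ} {f : Vec d → ℝ} {δ : ℝ} {T : ℕ} {w : ℕ → Vec d} {t : ℕ}
    (h : Performs f δ T w (t + 1)) : Performs f δ T w t :=
  ⟨(Nat.lt_succ_self t).trans h.1, fun s hs => h.2 s (hs.trans t.le_succ)⟩

end DINGO

theorem mainTheorem2 {d m : ℕ} (hm : 0 < m) (F : Fin m → DINGO.Vec d → ℝ)
    -- constants of the assumptions on the objective
    (K L γloc : Fin m → ℝ) (γ ν : ℝ)
    (hLip : DINGO.LocalLipschitz F K L)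
    (hloc : ∀ i, DINGO.PseudoInverseRegular (F i) (γloc i))
    -- automatic unless the Hessian of `F i` vanishes identically
    (hγK : ∀ i, γloc i ≤ K i)
    (hreg : DINGO.PseudoInverseRegular (DINGO.objective F) γ)
    (hnull : DINGO.GradientHessianNullSpace (DINGO.objective F) ν)
    -- inputs of the algorithm
    (θ φ ρ δ : ℝ) (T : ℕ) (hθ : 0 < θ) (hφ : 0 < φ) (hρ0 : 0 < ρ) (hρ1 : ρ < 1) (hδ : 0 ≤ δ)
    -- a run with inexact update
    (w : ℕ → DINGO.Vec d) (v1 v2 v3 : ℕ → Fin m → DINGO.Vec d)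
    (hrun : DINGO.IsInexactRun F θ ρ δ T w v1 v2 v3)
    (ε1 ε2 ε3 : Fin m → ℝ)
    (hinexact : DINGO.InexactnessCondition F φ δ T w v1 v2 v3 ε1 ε2 ε3)
    (hε3 : ∀ i, ε3 i < Real.sqrt (φ ^ 2 / (K i ^ 2 + φ ^ 2))) :
    ∀ t, DINGO.Performs (DINGO.objective F) δ T w t →
      -- the line search has a largest step-size, the one that is taken
      IsGreatest
        (DINGO.lineSearchSet (DINGO.objective F) ρ (w t) (DINGO.dirAt F θ w v1 v2 v3 t))
        (DINGO.stepSize (DINGO.objective F) ρ (w t) (DINGO.dirAt F θ w v1 v2 v3 t)) ∧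
      ‖gradient (DINGO.objective F) (w (t + 1))‖ ^ 2 ≤
        (1 - 2 * DINGO.tau ρ θ φ γ ν (DINGO.lipConst F K L (w 0)) K γloc ε1 ε2 ε3 * ρ * θ) *
          ‖gradient (DINGO.objective F) (w t)‖ ^ 2 := by
  open DINGO in
  have hF := fun i => (hLip i).1
  have hF' := fun i => (hLip i).2.1
  have hK0 := fun i => (hLip i).2.2.1
  have hKi : ∀ i x, ‖hess (F i) x‖ ≤ K i := fun i =>
    norm_hess_le (hK0 i).le fun x y => ((hLip i).2.2.2.2 x y).1
  have hf := differentiable_objective hF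
  have hf' : Differentiable ℝ (gradient (objective F)) := fun x =>
    (hasFDerivAt_gradient_objective hF hF' x).differentiableAt
  have hKm : 0 < mean K := mean_pos hm hK0
  have hLm : 0 < mean L := mean_pos hm fun i => (hLip i).2.2.2.1
  have hgl := norm_gradient_objective_sub_le hLip
  obtain ⟨hε, hinexact⟩ := hinexact
  set f := objective F with hfdef
  set M := lipConst F K L (w 0) with hM
  have hKM : mean K ^ 2 ≤ M := le_add_of_nonneg_right (by positivity)
  have hM0 : 0 < M := lt_of_lt_of_le (by positivity) hKM
  set c₁ := mean fun i => (γloc i + ε1 i * K i) / γloc i ^ 2 with hc₁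
  -- each summand of `c₁` is at least `1 / γ_i ≥ 1 / K_i`
  have hc₁K : 1 ≤ c₁ * mean K := by
    refine one_le_mean_mul_mean hm (fun i => ?_) (fun i => (hK0 i).le) fun i => ?_
    all_goals
      have h1 := (hloc i).1
      have h2 := (hε i).1.1
      have h3 := hK0 i
    · positivity
    · rw [div_mul_eq_mul_div, one_le_div (by positivity)]
      nlinarith [hγK i, mul_nonneg h2 (mul_nonneg h3.le h3.le)]
  have hτ₁ : tau ρ θ φ γ ν M K γloc ε1 ε2 ε3 ≤ 2 * (1 - ρ) * θ / (M * c₁ ^ 2) := by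
    have hc₁0 : 0 < c₁ := pos_of_mul_pos_left (one_pos.trans_le hc₁K) hKm.le
    refine (min_le_left _ _).trans (le_of_eq ?_)
    rw [tau1, ← hc₁]
    field_simp
  have hslope : ∀ t, Performs f δ T w t →
      inner ℝ (dirAt F θ w v1 v2 v3 t) (hess f (w t) (gradient f (w t))) ≤
        -(θ * ‖gradient f (w t)‖ ^ 2) := fun t ht =>
    inner_direction_le hm fun i => (hinexact t ht i).2.2.2
  have hstep : ∀ t, Performs f δ T w t → ‖gradient f (w t)‖ ≤ ‖gradient f (w 0)‖ →
      IsGreatest (lineSearchSet f ρ (w t) (dirAt F θ w v1 v2 v3 t))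
        (stepSize f ρ (w t) (dirAt F θ w v1 v2 v3 t)) ∧
      ‖gradient f (w (t + 1))‖ ^ 2 ≤
        (1 - 2 * tau ρ θ φ γ ν M K γloc ε1 ε2 ε3 * ρ * θ) * ‖gradient f (w t)‖ ^ 2 := by
    intro t ht hle
    rw [hrun t ht]
    have hsl := hslope t ht
    set p := dirAt F θ w v1 v2 v3 t with hp
    set g := gradient f (w t) with hg
    have hg0 : 0 < ‖g‖ := hδ.trans_lt (ht.2 t le_rfl)
    have hquad : ∀ α : ℝ, 0 ≤ α → ‖gradient f (w t + α • p)‖ ^ 2 ≤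
        ‖g‖ ^ 2 + 2 * α * inner ℝ p (hess f (w t) g) + α ^ 2 * (M * ‖p‖ ^ 2) := by
      intro α hα
      refine (norm_gradient_sq_le hKm.le hf hf' hgl
        (norm_hess_objective_sub_le hLip) (w t) p hα).trans ?_
      rw [hM, lipConst]
      gcongr
    -- It suffices to bound `‖p‖ / ‖g‖` by a constant `c` whose rate is one of those in the minimum:
    -- the minimum also includes the rate of `c₁`, so `max c₁ c` can be used, for which both lower
    -- bounds needed for the line search hold, whether or not the rate exceeds `1`.
    have finish : ∀ c, ‖p‖ ≤ c * ‖g‖ →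
        tau ρ θ φ γ ν M K γloc ε1 ε2 ε3 ≤ 2 * (1 - ρ) * θ / (M * c ^ 2) →
        IsGreatest (lineSearchSet f ρ (w t) p) (stepSize f ρ (w t) p) ∧
          ‖gradient f (w t + stepSize f ρ (w t) p • p)‖ ^ 2 ≤
            (1 - 2 * tau ρ θ φ γ ν M K γloc ε1 ε2 ε3 * ρ * θ) * ‖g‖ ^ 2 := by
      intro c hc hτc
      have hθc : θ ≤ mean K * c := by
        have h1 : θ * ‖g‖ ^ 2 ≤ mean K * c * ‖g‖ ^ 2 := by
          calc θ * ‖g‖ ^ 2 ≤ |inner ℝ p (hess f (w t) g)| :=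
                (le_neg.2 hsl).trans (neg_le_abs _)
            _ ≤ ‖p‖ * ‖hess f (w t) g‖ := abs_real_inner_le_norm _ _
            _ ≤ (c * ‖g‖) * (mean K * ‖g‖) := by
                gcongr
                · exact (norm_nonneg _).trans hc
                · exact (hess f (w t)).le_of_opNorm_le (norm_hess_le hKm.le hgl _) _
            _ = _ := by ring
        exact le_of_mul_le_mul_right h1 (by positivity)
      have hsq : ∀ x, 0 ≤ x → x ≤ mean K * max c₁ c → x ^ 2 ≤ M * max c₁ c ^ 2 := by
        intro x hx0 hx
        calc x ^ 2 ≤ (mean K * max c₁ c) ^ 2 := by gcongr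
          _ = mean K ^ 2 * max c₁ c ^ 2 := by ring
          _ ≤ _ := by gcongr
      refine lineSearch_decrease hf'.continuous (C := max c₁ c) hθ hρ0 hρ1 hM0 hg0 hquad hsl
        (hc.trans (by gcongr; exact le_max_right _ _)) ?_ ?_ ?_
      · simpa using hsq 1 zero_le_one (by
          rw [mul_comm] at hc₁K
          exact hc₁K.trans (by gcongr; exact le_max_left _ _))
      · exact hsq θ hθ.le (hθc.trans (by gcongr; exact le_max_right _ _))
      · rcases max_choice c₁ c with h | h <;> rw [h]
        · exact hτ₁
        · exact hτc
    rcases norm_direction_le (H := fun i => hess (F i) (w t)) hm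
      (fun i => inner_hess_symm (hF i) (hF' i) (w t)) (fun i => hKi i (w t))
      (fun i => (hloc i).1) (fun i => (hloc i).2 (w t)) hreg.1 hnull.1
      (norm_gradient_le (fun x => inner_hess_symm hf hf' x) hreg hnull (w t)) hθ hφ
      (fun i => (hε i).1.1) (fun i => (hε i).2.1.1) (fun i => (hε i).2.2.1) hε3
      (fun i => (hinexact t ht i).1.1) (fun i => (hinexact t ht i).1.2)
      (fun i => (hinexact t ht i).2.1) (fun i => (hinexact t ht i).2.2.1)
      (fun i => (hinexact t ht i).2.2.2) with h | h | h
    · exact finish _ h hτ₁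
    · exact finish _ h ((min_le_right _ _).trans (min_le_left _ _))
    · exact finish _ h ((min_le_right _ _).trans (min_le_right _ _))
  have hmono : ∀ t, Performs f δ T w t → ‖gradient f (w t)‖ ≤ ‖gradient f (w 0)‖ := by
    intro t
    induction t with
    | zero => exact fun _ => le_rfl
    | succ t ih =>
      intro ht
      have ht' := ht.of_succ
      refine le_trans ?_ (ih ht')
      have hmem := (hstep t ht' (ih ht')).1.1
      rw [hrun t ht']
      refine le_of_sq_le_sq (hmem.2.2.trans (add_le_of_nonpos_right ?_)) (norm_nonneg _)
      have hα := hmem.1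
      exact mul_nonpos_of_nonneg_of_nonpos (by positivity)
        ((hslope t ht').trans (neg_nonpos.2 (by positivity)))
  exact fun t ht => hstep t ht (hmono t ht)
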